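/- Let $\nu\subseteq\lambda$ be partitions and let $\sigma=\lambda/\nu$ be a skew shape (in English notation), of height $a$ (number of rows containing a box of $\sigma$) and width $b$ (number of columns containing a box of $\sigma$). Place $\sigma$ in an $a\times b$ rectangle whose northwest vertex is the point $(0,0)$ and whose southeast vertex is $(a,b)$, and write $[i,j]$ for the box whose southeast vertex is $(i,j)$. Let $P_\sigma$ be the poset of boxes of $\sigma$, with $[i,j]\le[k,l]$ if and only if $i\le k$ and $j\le l$. The shape $\sigma$ is connected if $P_\sigma$ is nonempty and its Hasse diagram is connected. An outward corner of a connected $\sigma$ consists of two consecutive steps along the boundary of $\sigma$ that do not belong to the same line and do not border a common box of $\sigma$; it occurs at the lattice point $(i,j)$ where the two steps meet, and it is part either of the northwest or of the southeast border of $\sigma$. Its displacement is $1-\frac ia-\frac jb$ in the first case and $-1+\frac ia+\frac jb$ in the second. Call $\sigma$ balanced if it is connected and all its outward corners have displacement $0$. For a finite poset $P$ let $\mathcal J(P)$ be the set of order ideals of $P$. For $p\in P$ let the toggle $\tau_p:\mathcal J(P)\to\mathcal J(P)$ send $I$ to the symmetric difference $I\,\triangle\,\{p\}$ if this is an order ideal,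 and to $I$ otherwise. Rowmotion is $\tau_{\ell^{-1}(1)}\circ\tau_{\ell^{-1}(2)}\circ\cdots\circ\tau_{\ell^{-1}(n)}$, where $n=\#P$ and $\ell:P\to\{1,\dots,n\}$ is any linear extension of $P$. If $P$ has a rank function, i.e. a map $\mathrm{rk}:P\to\mathbb Z_{\ge0}$ that attains the value $0$ and satisfies $\mathrm{rk}(q)=\mathrm{rk}(p)+1$ whenever $q$ covers $p$ (as $P_\sigma$ does when $\sigma$ is connected), gyration is $\tau_{o_1}\circ\cdots\circ\tau_{o_{n_1}}\circ\tau_{e_1}\circ\cdots\circ\tau_{e_{n_0}}$, where $e_1,\dots,e_{n_0}$ are the elements of even rank and $o_1,\dots,o_{n_1}$ those of odd rank, in any order. The antichain cardinality statistic on $\mathcal J(P)$ sends $I$ to the number of maximal elements of $I$. **Statement.** If $\sigma$ is a balanced skew shape of height $a$ and width $b$, and $\varphi:\mathcal J(P_\sigma)\to\mathcal J(P_\sigma)$ is rowmotion or gyration, then the antichain cardinality statistic is $\frac{ab}{a+b}$-mesic with respect to the action of $\varphi$: for every $\varphi$-orbit $\mathcal O\subseteq\mathcal J(P_\sigma)$,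 $$\frac1{\#\mathcal O}\sum_{I\in\mathcal O}\#\{\text{maximal elements of } I\}=\frac{ab}{a+b}.$$ -/

import Mathlib

/-! ### Toggles, rowmotion and gyration on the order ideals of a finite poset

Order ideals of `P` are Mathlib's `LowerSet P`. -/

section Toggle

variable {P : Type*} [PartialOrder P]

open Classical in
/-- The underlying map of the toggle at `p`: `I ↦ I ∆ {p}` if this is an order ideal, and `I ↦ I`
otherwise. -/
noncomputable def toggleFun (p : P) (I : LowerSet P) : LowerSet P :=
  if h : IsLowerSet (symmDiff (I : Set P) {p}) then ⟨symmDiff (I : Set P) {p}, h⟩ else I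

theorem toggleFun_involutive (p : P) : Function.Involutive (toggleFun p) := by
  intro I
  by_cases h : IsLowerSet (symmDiff (I : Set P) {p})
  · have h1 : toggleFun p I = ⟨symmDiff (I : Set P) {p}, h⟩ := dif_pos h
    have h2 : symmDiff (symmDiff (I : Set P) {p}) {p} = (I : Set P) :=
      symmDiff_symmDiff_cancel_right _ _
    rw [h1, toggleFun, dif_pos]
    · exact SetLike.coe_injective h2
    · change IsLowerSet (symmDiff (symmDiff (I : Set P) {p}) {p})
      rw [h2]
      exact I.lower
  · have h1 : toggleFun p I = I := dif_neg h
    rw [h1, h1]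

/-- The toggle `τ_p`, as a permutation of the set of order ideals. -/
noncomputable def toggle (p : P) : Equiv.Perm (LowerSet P) :=
  (toggleFun_involutive p).toPerm

/-- The composition `τ_{p₁} ∘ τ_{p₂} ∘ ⋯ ∘ τ_{pₖ}` for a list `[p₁, …, pₖ]` (the product of
permutations is composition, so `τ_{pₖ}` is applied first). -/
noncomputable def toggleList (l : List P) : Equiv.Perm (LowerSet P) :=
  (l.map toggle).prod

/-- A linear extension of a finite poset with `n` elements: a bijection with an `n`-element chain
that preserves the order. -/
def IsLinearExtension [Fintype P] (ℓ : P ≃ Fin (Fintype.card P)) : Prop :=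
  ∀ p q : P, p ≤ q → ℓ p ≤ ℓ q

/-- `φ` is rowmotion: `φ = τ_{ℓ⁻¹(1)} ∘ τ_{ℓ⁻¹(2)} ∘ ⋯ ∘ τ_{ℓ⁻¹(n)}` for some linear extension
`ℓ` (all linear extensions give the same permutation). -/
def IsRowmotion [Fintype P] (φ : Equiv.Perm (LowerSet P)) : Prop :=
  ∃ ℓ : P ≃ Fin (Fintype.card P), IsLinearExtension ℓ ∧ φ = toggleList (List.ofFn ℓ.symm)

/-- A rank function: it increases by one along each cover, and attains the value `0`. -/
def IsRankFunction (rk : P → ℕ) : Prop :=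
  (∀ p q : P, p ⋖ q → rk q = rk p + 1) ∧ ∃ p, rk p = 0

/-- `φ` is gyration: `φ = τ_{o₁} ∘ ⋯ ∘ τ_{oₘ} ∘ τ_{e₁} ∘ ⋯ ∘ τ_{eₖ}`, where `e₁, …, eₖ` are the
elements of even rank and `o₁, …, oₘ` those of odd rank, each listed once, in any order. -/
def IsGyration (φ : Equiv.Perm (LowerSet P)) : Prop :=
  ∃ rk : P → ℕ, IsRankFunction rk ∧
    ∃ o e : List P, o.Nodup ∧ (∀ p, p ∈ o ↔ Odd (rk p)) ∧ e.Nodup ∧ (∀ p, p ∈ e ↔ Even (rk p)) ∧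
      φ = toggleList o * toggleList e

/-- The antichain cardinality statistic `I ↦ #A(I)`, where `A(I)` is the set of maximal elements
of the order ideal `I`. -/
noncomputable def antichainCard (I : LowerSet P) : ℝ :=
  ({p : P | Maximal (· ∈ I) p}.ncard : ℝ)

end Toggle

/-- The statistic `f` on the finite set `S` is `c`-mesic under the action of the permutation `φ`:
its average over each `φ`-orbit is `c`. -/
def IsMesic {S : Type*} [Finite S] (φ : Equiv.Perm S) (f : S → ℝ) (c : ℝ) : Prop :=
  ∀ s : S, (∑ᶠ t ∈ MulAction.orbit (Subgroup.zpowers φ) s, f t) /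
    ((MulAction.orbit (Subgroup.zpowers φ) s).ncard : ℝ) = c

/-! ### Skew shapes -/

/-- A skew shape `λ/ν`, given by partitions (Young diagrams) `ν ⊆ λ`. -/
structure SkewShape where
  /-- the outer partition `λ` -/
  outer : YoungDiagram
  /-- the inner partition `ν` -/
  inner : YoungDiagram
  inner_le : inner ≤ outer

namespace SkewShape

/-- The boxes of `λ/ν`, in the row and column indices (starting from `0`) of `λ`. -/
def cells (σ : SkewShape) : Finset (ℕ × ℕ) := σ.outer.cells \ σ.inner.cells

/-- The poset `P_σ` of boxes, with the order induced from the product order of `ℕ × ℕ`. -/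
abbrev BoxPoset (σ : SkewShape) : Type := {x : ℕ × ℕ // x ∈ σ.cells}

/-- The height of `σ`: the number of rows that contain a box of `σ`. -/
def height (σ : SkewShape) : ℕ := (σ.cells.image Prod.fst).card

/-- The width of `σ`: the number of columns that contain a box of `σ`. -/
def width (σ : SkewShape) : ℕ := (σ.cells.image Prod.snd).card

/-- The index of the topmost row of `σ`. -/
noncomputable def topRow (σ : SkewShape) : ℕ := sInf {i | ∃ j, (i, j) ∈ σ.cells}

/-- The index of the leftmost column of `σ`. -/
noncomputable def leftCol (σ : SkewShape) : ℕ := sInf {j | ∃ i, (i, j) ∈ σ.cells}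

/-- `σ` contains the box `[i, j]`: the box whose southeast vertex is the lattice point `(i, j)`, in
the coordinates (row coordinate first, increasing downwards) for which the northwest vertex of the
bounding rectangle of `σ` is `(0, 0)`. -/
def HasBox (σ : SkewShape) (i j : ℕ) : Prop :=
  ∃ x ∈ σ.cells, x.1 + 1 = σ.topRow + i ∧ x.2 + 1 = σ.leftCol + j

/-- `σ` is connected: its poset is nonempty with connected Hasse diagram. -/
def IsConnected (σ : SkewShape) : Prop := (SimpleGraph.hasse σ.BoxPoset).Connected

/-- An outward corner of `σ` on its northwest border occurs at `(i, j)`. Its two steps are the edge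
from `(i, j)` to the west, which separates the boxes `[i, j]` and `[i+1, j]`, and the edge to the
north, which separates `[i, j]` and `[i, j+1]`: both lie on the boundary, and they do not border a
common box of `σ`, because `[i, j]` is not in `σ`. -/
def IsNWCorner (σ : SkewShape) (i j : ℕ) : Prop :=
  σ.HasBox (i + 1) j ∧ σ.HasBox i (j + 1) ∧ ¬ σ.HasBox i j

/-- An outward corner of `σ` on its southeast border occurs at `(i, j)`. Its two steps are the edge
from `(i, j)` to the south, which separates the boxes `[i+1, j]` and `[i+1, j+1]`, and the edge to
the east, which separates `[i, j+1]` and `[i+1, j+1]`: both lie on the boundary, and they do not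
border a common box of `σ`, because `[i+1, j+1]` is not in `σ`. -/
def IsSECorner (σ : SkewShape) (i j : ℕ) : Prop :=
  σ.HasBox (i + 1) j ∧ σ.HasBox i (j + 1) ∧ ¬ σ.HasBox (i + 1) (j + 1)

/-- The displacement of a northwest outward corner at `(i, j)`. -/
noncomputable def nwDisplacement (σ : SkewShape) (i j : ℕ) : ℝ :=
  1 - (i : ℝ) / σ.height - (j : ℝ) / σ.width

/-- The displacement of a southeast outward corner at `(i, j)`. -/
noncomputable def seDisplacement (σ : SkewShape) (i j : ℕ) : ℝ :=
  -1 + (i : ℝ) / σ.height + (j : ℝ) / σ.width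

/-- `σ` is balanced: it is connected and all its outward corners have displacement `0`. -/
def IsBalanced (σ : SkewShape) : Prop :=
  σ.IsConnected ∧ (∀ i j, σ.IsNWCorner i j → σ.nwDisplacement i j = 0) ∧
    ∀ i j, σ.IsSECorner i j → σ.seDisplacement i j = 0

end SkewShape

/-! ### Existence of the maps above -/

theorem exists_isRowmotion {P : Type*} [PartialOrder P] [Fintype P] :
    ∃ φ : Equiv.Perm (LowerSet P), IsRowmotion φ := by
  classical
  let _ : Fintype (LinearExtension P) := inferInstanceAs (Fintype P)
  have hc : Fintype.card (LinearExtension P) = Fintype.card P := rfl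
  let e : Fin (Fintype.card P) ≃o LinearExtension P := Fintype.orderIsoFinOfCardEq _ hc
  refine ⟨_, (Equiv.refl P : P ≃ LinearExtension P).trans e.symm.toEquiv, ?_, rfl⟩
  intro p q h
  exact e.symm.monotone ((toLinearExtension (α := P)).monotone h)

theorem SkewShape.exists_isRankFunction (σ : SkewShape) (hσ : Nonempty σ.BoxPoset) :
    ∃ rk : σ.BoxPoset → ℕ, IsRankFunction rk := by
  obtain ⟨m, hm⟩ := Finite.exists_min (fun x : σ.BoxPoset => x.1.1 + x.1.2)
  refine ⟨fun x => x.1.1 + x.1.2 - (m.1.1 + m.1.2), ?_, m, by simp⟩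
  rintro ⟨⟨i, j⟩, hp⟩ ⟨⟨k, l⟩, hq⟩ h
  have hle : i ≤ k ∧ j ≤ l := h.le
  have hne : ¬ (i = k ∧ j = l) := by
    rintro ⟨rfl, rfl⟩; exact lt_irrefl _ h.lt
  have hmp := hm ⟨(i, j), hp⟩
  have conv : ∀ u v, i ≤ u → u ≤ k → j ≤ v → v ≤ l → (u, v) ∈ σ.cells := by
    intro u v h1 h2 h3 h4
    simp only [SkewShape.cells, Finset.mem_sdiff, YoungDiagram.mem_cells] at hp hq ⊢
    exact ⟨σ.outer.up_left_mem h2 h4 hq.1, fun hc => hp.2 (σ.inner.up_left_mem h1 h3 hc)⟩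
  have key : ∀ u v, i ≤ u → u ≤ k → j ≤ v → v ≤ l → (u = i ∧ v = j) ∨ (u = k ∧ v = l) := by
    intro u v h1 h2 h3 h4
    by_contra! hcon
    refine h.2 (c := ⟨(u, v), conv u v h1 h2 h3 h4⟩) ?_ ?_
    · refine lt_of_le_of_ne (show (i, j) ≤ (u, v) from ⟨h1, h3⟩) ?_
      intro he
      simp only [Subtype.mk.injEq, Prod.mk.injEq] at he
      exact hcon.1 he.1.symm he.2.symm
    · refine lt_of_le_of_ne (show (u, v) ≤ (k, l) from ⟨h2, h4⟩) ?_
      intro he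
      simp only [Subtype.mk.injEq, Prod.mk.injEq] at he
      exact hcon.2 he.1 he.2
  simp only at hmp ⊢
  by_cases hik : i = k
  · have := key i (j + 1) le_rfl hle.1 (by omega) (by omega)
    omega
  · have := key (i + 1) j (by omega) (by omega) le_rfl hle.2
    omega

theorem SkewShape.exists_isGyration (σ : SkewShape) (hσ : Nonempty σ.BoxPoset) :
    ∃ φ : Equiv.Perm (LowerSet σ.BoxPoset), IsGyration φ := by
  classical
  obtain ⟨rk, h⟩ := σ.exists_isRankFunction hσ
  exact ⟨_, rk, h, (Finset.univ.filter fun p => Odd (rk p)).toList,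
    (Finset.univ.filter fun p => Even (rk p)).toList, Finset.nodup_toList _, by simp,
    Finset.nodup_toList _, by simp, rfl⟩

/-! ### Toggles and membership in the toggled ideal -/

section Toggle

variable {P : Type*} [PartialOrder P]

/-! Antichain cardinality equals ab/(a+b) plus a linear combination of the signed toggleabilities
T_p. Each T_p is a coboundary g ∘ φ - g for rowmotion and for gyration, so it sums to zero over
every orbit.

For the linear combination, regard an ideal I as the lattice path bounding ν ∪ I, and let
`SkewShape.weight` be the affine function of lattice points that vanishes on the southwest-northeast
diagonal of the bounding rectangle. Weigh each maximal box of I at its southeast vertex and each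
minimal box of the complement at its northwest vertex. Crossing a box diagonally adds a + b, so the
difference of the two sums is (a+b)·#max(I) - ∑ weight(p)·T_p(I). The other turns of the path
between two rows of σ are outward corners of σ, where balance makes the weight vanish, so they may
be included. The two ends of each horizontal run then differ by a times its length, and telescoping
leaves ab (`SkewShape.IsBalanced.sum_maximalWeight_sub`). -/

theorem mem_toggle_of_ne {p q : P} (h : q ≠ p) (I : LowerSet P) : q ∈ toggle p I ↔ q ∈ I := by
  change q ∈ toggleFun p I ↔ q ∈ I
  unfold toggleFun
  split_ifs with hI
  · change q ∈ symmDiff (I : Set P) {p} ↔ q ∈ I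
    simp [Set.mem_symmDiff, h]
  · rfl

theorem mem_toggle_self (p : P) (I : LowerSet P) :
    p ∈ toggle p I ↔ Minimal (· ∉ I) p ∨ p ∈ I ∧ ¬ Maximal (· ∈ I) p := by
  change p ∈ toggleFun p I ↔ _
  unfold toggleFun
  split_ifs with hI
  · change p ∈ symmDiff (I : Set P) {p} ↔ _
    have key : ∀ ⦃x y : P⦄, y ≤ x → x ∈ symmDiff (I : Set P) {p} →
      y ∈ symmDiff (I : Set P) {p} := hI
    simp only [Set.mem_symmDiff, SetLike.mem_coe, Set.mem_singleton_iff] at key ⊢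
    by_cases hp : p ∈ I
    · have h1 : Maximal (· ∈ I) p := by
        refine ⟨hp, fun y hy hpy => ?_⟩
        by_contra hcon
        have hne : y ≠ p := by rintro rfl; exact hcon le_rfl
        have := key hpy (Or.inl ⟨hy, hne⟩)
        simp [hp] at this
      have h2 : ¬ Minimal (· ∉ I) p := fun h => h.prop hp
      simp [hp, h1, h2]
    · have h1 : Minimal (· ∉ I) p := by
        refine ⟨hp, fun y hy hpy => ?_⟩
        rcases key hpy (Or.inr ⟨rfl, hp⟩) with h | h
        · exact absurd h.1 hy
        · exact h.1.ge
      simp [hp, h1]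
  · constructor
    · intro hp
      refine Or.inr ⟨hp, fun hmax => hI ?_⟩
      intro x y hyx hx
      simp only [Set.mem_symmDiff, SetLike.mem_coe, Set.mem_singleton_iff] at hx ⊢
      rcases hx with ⟨hx, hne⟩ | ⟨rfl, hx⟩
      · refine Or.inl ⟨I.lower hyx hx, ?_⟩
        rintro rfl
        exact hne (hmax.eq_of_ge hx hyx)
      · exact absurd hp hx
    · rintro (hmin | h)
      · exfalso
        apply hI
        intro x y hyx hx
        simp only [Set.mem_symmDiff, SetLike.mem_coe, Set.mem_singleton_iff] at hx ⊢
        rcases hx with ⟨hx, -⟩ | ⟨rfl, -⟩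
        · refine Or.inl ⟨I.lower hyx hx, ?_⟩
          rintro rfl
          exact hmin.prop (I.lower hyx hx)
        · by_cases hy : y ∈ I
          · refine Or.inl ⟨hy, ?_⟩
            rintro rfl
            exact hmin.prop hy
          · exact Or.inr ⟨hmin.eq_of_le hy hyx, hy⟩
      · exact h.1

theorem toggleList_cons (p : P) (l : List P) (I : LowerSet P) :
    toggleList (p :: l) I = toggle p (toggleList l I) := by
  simp [toggleList]

theorem toggleList_append (l m : List P) (I : LowerSet P) :
    toggleList (l ++ m) I = toggleList l (toggleList m I) := by
  simp [toggleList]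

theorem mem_toggleList_of_notMem {q : P} {l : List P} (h : q ∉ l) (I : LowerSet P) :
    q ∈ toggleList l I ↔ q ∈ I := by
  induction l with
  | nil => simp [toggleList]
  | cons p l ih =>
    rw [List.mem_cons, not_or] at h
    rw [toggleList_cons, mem_toggle_of_ne h.1, ih h.2]

theorem minimal_notMem_lowerSet_iff {I : LowerSet P} {p : P} :
    Minimal (· ∉ I) p ↔ p ∉ I ∧ ∀ q, q < p → q ∈ I := by
  rw [minimal_iff_forall_lt]
  simp

theorem maximal_mem_lowerSet_iff {I : LowerSet P} {p : P} :
    Maximal (· ∈ I) p ↔ p ∈ I ∧ ∀ q, p < q → q ∉ I := by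
  rw [maximal_iff_forall_gt]

/-- If a sequence of toggles reaches the elements above `p` before `p` and those below `p` after
`p`, then it makes `p` a maximal element of the ideal exactly when `p` was a minimal element of
the complement. -/
theorem maximal_toggleList_iff {l m : List P} {p : P} (hpl : p ∉ l) (hpm : p ∉ m)
    (hl : ∀ q, p < q → q ∉ l) (hm : ∀ q, q < p → q ∉ m) (I : LowerSet P) :
    Maximal (· ∈ toggleList (l ++ p :: m) I) p ↔ Minimal (· ∉ I) p := by
  rw [toggleList_append, toggleList_cons, maximal_mem_lowerSet_iff, minimal_notMem_lowerSet_iff,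
    mem_toggleList_of_notMem hpl]
  have h1 : ∀ q, p < q → (q ∈ toggleList l (toggle p (toggleList m I)) ↔ q ∈ toggleList m I) :=
    fun q hq => by rw [mem_toggleList_of_notMem (hl q hq), mem_toggle_of_ne hq.ne']
  have h2 : ∀ q, q < p → (q ∈ toggleList m I ↔ q ∈ I) :=
    fun q hq => mem_toggleList_of_notMem (hm q hq) I
  have h3 : p ∈ toggleList m I ↔ p ∈ I := mem_toggleList_of_notMem hpm I
  rw [mem_toggle_self, minimal_notMem_lowerSet_iff, maximal_mem_lowerSet_iff, h3]
  constructor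
  · rintro ⟨h | h, hq⟩
    · exact ⟨h.1, fun q hqp => (h2 q hqp).1 (h.2 q hqp)⟩
    · exact absurd ⟨h.1, fun q hpq hqm => hq q hpq ((h1 q hpq).2 hqm)⟩ h.2
  · rintro ⟨hp, hq⟩
    refine ⟨Or.inl ⟨hp, fun q hqp => (h2 q hqp).2 (hq q hqp)⟩, fun q hpq hqm => hp ?_⟩
    exact h3.1 ((toggleList m I).lower hpq.le ((h1 q hpq).1 hqm))

theorem minimal_notMem_lowerSet_iff_covBy [Finite P] {I : LowerSet P} {p : P} :
    Minimal (· ∉ I) p ↔ p ∉ I ∧ ∀ q, q ⋖ p → q ∈ I := by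
  rw [minimal_notMem_lowerSet_iff]
  refine and_congr_right fun _ => ⟨fun h q hq => h q hq.lt, fun h q hq => ?_⟩
  obtain ⟨c, hqc, hc⟩ := exists_le_covBy_of_lt hq
  exact I.lower hqc (h c hc)

theorem maximal_mem_lowerSet_iff_covBy [Finite P] {I : LowerSet P} {p : P} :
    Maximal (· ∈ I) p ↔ p ∈ I ∧ ∀ q, p ⋖ q → q ∉ I := by
  rw [maximal_mem_lowerSet_iff]
  refine and_congr_right fun _ => ⟨fun h q hq => h q hq.lt, fun h q hq hqI => ?_⟩
  obtain ⟨c, hc, hcq⟩ := exists_covBy_le_of_lt hq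
  exact h c hc (I.lower hcq hqI)

/-- Toggling `p` once, and no element that covers `p` or is covered by `p`, changes the membership
of `p` exactly when `p` can be toggled. -/
theorem mem_toggleList_iff [Finite P] {l : List P} {p : P} (hl : l.Nodup) (hp : p ∈ l)
    (hlow : ∀ q, q ⋖ p → q ∉ l) (hup : ∀ q, p ⋖ q → q ∉ l) (I : LowerSet P) :
    p ∈ toggleList l I ↔ Minimal (· ∉ I) p ∨ p ∈ I ∧ ¬ Maximal (· ∈ I) p := by
  obtain ⟨s, t, rfl⟩ := List.append_of_mem hp
  rw [List.nodup_middle, List.nodup_cons, List.mem_append, not_or] at hl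
  have h1 : ∀ q, q ⋖ p → (q ∈ toggleList t I ↔ q ∈ I) := fun q hq =>
    mem_toggleList_of_notMem (fun h => hlow q hq (by simp [h])) I
  have h2 : ∀ q, p ⋖ q → (q ∈ toggleList t I ↔ q ∈ I) := fun q hq =>
    mem_toggleList_of_notMem (fun h => hup q hq (by simp [h])) I
  rw [toggleList_append, toggleList_cons, mem_toggleList_of_notMem hl.1.1, mem_toggle_self,
    minimal_notMem_lowerSet_iff_covBy, maximal_mem_lowerSet_iff_covBy, minimal_notMem_lowerSet_iff_covBy,
    maximal_mem_lowerSet_iff_covBy, mem_toggleList_of_notMem hl.1.2]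
  grind

/-! ### Signed toggleability is a coboundary -/

open Classical in
/-- The signed toggleability statistic of `p`: `1` if `p` can be toggled in, `-1` if it can be
toggled out, and `0` otherwise. -/
noncomputable def toggleability (p : P) (I : LowerSet P) : ℝ :=
  (if Minimal (· ∉ I) p then 1 else 0) - (if Maximal (· ∈ I) p then 1 else 0)

theorem IsRowmotion.toggleability_eq [Fintype P] {φ : Equiv.Perm (LowerSet P)}
    (hφ : IsRowmotion φ) (p : P) :
    ∃ g : LowerSet P → ℝ, ∀ I, toggleability p I = g (φ I) - g I := by
  classical
  obtain ⟨ℓ, hℓ, rfl⟩ := hφ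
  -- Rowmotion makes p maximal exactly when p could be toggled in, so the two terms of the
  -- toggleability are one indicator at φ I and at I.
  refine ⟨fun I => if Maximal (· ∈ I) p then 1 else 0, fun I => ?_⟩
  have hsort : (List.ofFn ℓ.symm).Pairwise (fun x y => ℓ x < ℓ y) := by
    rw [List.pairwise_ofFn]
    intro i j hij
    simpa using hij
  obtain ⟨s, t, hst⟩ := List.append_of_mem
    (show p ∈ List.ofFn ℓ.symm from (List.mem_ofFn' _ _).2 ⟨ℓ p, by simp⟩)
  rw [hst] at hsort ⊢
  rw [List.pairwise_append, List.pairwise_cons] at hsort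
  obtain ⟨-, ⟨ht, -⟩, hs⟩ := hsort
  have hs' : ∀ q ∈ s, ℓ q < ℓ p := fun q hq => hs q hq p (by simp)
  simp only [toggleability, maximal_toggleList_iff (l := s) (m := t) (p := p)
    (fun h => lt_irrefl _ (hs' p h)) (fun h => lt_irrefl _ (ht p h))
    (fun q hq h => (hs' q h).not_ge (hℓ _ _ hq.le))
    (fun q hq h => (ht q h).not_ge (hℓ _ _ hq.le)) I]

theorem IsGyration.toggleability_eq [Finite P] {φ : Equiv.Perm (LowerSet P)}
    (hφ : IsGyration φ) (p : P) :
    ∃ g : LowerSet P → ℝ, ∀ I, toggleability p I = g (φ I) - g I := by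
  classical
  obtain ⟨rk, ⟨hrk, -⟩, o, e, ho, hom, he, hem, rfl⟩ := hφ
  rcases Nat.even_or_odd (rk p) with hp | hp
  -- Even elements are toggled first and no two are related by a cover, so p enters or leaves
  -- according to its toggleability in I itself.
  · refine ⟨fun I => if p ∈ I then 1 else 0, fun I => ?_⟩
    have hpo : p ∉ o := fun h => Nat.not_odd_iff_even.2 hp ((hom p).1 h)
    have key := mem_toggleList_iff he ((hem p).2 hp)
      (fun q hq h => by
        have h1 := (hem q).1 h; rw [hrk q p hq] at hp
        exact Nat.not_even_iff_odd.2 h1.add_one hp)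
      (fun q hq h => by
        have h1 := (hem q).1 h; rw [hrk p q hq] at h1
        exact Nat.not_even_iff_odd.2 hp.add_one h1) I
    have h1 : Minimal (· ∉ I) p → p ∉ I := fun h => h.prop
    have h2 : Maximal (· ∈ I) p → p ∈ I := fun h => h.prop
    simp only [toggleability, Equiv.Perm.mul_apply, mem_toggleList_of_notMem hpo, key]
    by_cases hpI : p ∈ I <;> by_cases hmax : Maximal (· ∈ I) p <;>
      by_cases hmin : Minimal (· ∉ I) p <;> simp_all
  -- The odd toggles come last, so the toggleability of p in I records, with reversed sign, the
  -- change of p in the step that produced I. Hence the potential looks one step back along the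
  -- orbit.
  · refine ⟨fun I => -if p ∈ (toggleList o * toggleList e).symm I then 1 else 0, fun I => ?_⟩
    have hpe : p ∉ e := fun h => Nat.not_odd_iff_even.2 ((hem p).1 h) hp
    have hlow : ∀ q, q ⋖ p → q ∉ o := fun q hq h => by
      have h1 := (hom q).1 h; rw [hrk q p hq] at hp
      exact Nat.not_odd_iff_even.2 h1.add_one hp
    have hup : ∀ q, p ⋖ q → q ∉ o := fun q hq h => by
      have h1 := (hom q).1 h; rw [hrk p q hq] at h1
      exact Nat.not_odd_iff_even.2 hp.add_one h1
    suffices H : ∀ J, toggleability p (toggleList o J) =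
        (if p ∈ J then 1 else 0) - if p ∈ toggleList o J then 1 else 0 by
      obtain ⟨K, rfl⟩ := (toggleList o * toggleList e).surjective I
      have h1 := mem_toggleList_of_notMem hpe K
      have h2 := H (toggleList e K)
      simp only [Equiv.symm_apply_apply]
      simp only [Equiv.Perm.mul_apply, h2, h1, neg_sub_neg]
      congr
    intro J
    have key := mem_toggleList_iff ho ((hom p).2 hp) hlow hup J
    have hlow' : ∀ q, q ⋖ p → (q ∈ toggleList o J ↔ q ∈ J) := fun q hq =>
      mem_toggleList_of_notMem (hlow q hq) J
    have hup' : ∀ q, p ⋖ q → (q ∈ toggleList o J ↔ q ∈ J) := fun q hq =>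
      mem_toggleList_of_notMem (hup q hq) J
    -- The neighbours of p are fixed by the odd toggles, so p can be toggled again exactly when it
    -- has just been toggled.
    have hmin : Minimal (· ∉ toggleList o J) p ↔ p ∉ toggleList o J ∧ p ∈ J := by
      rw [minimal_notMem_lowerSet_iff_covBy] at key ⊢
      have hJ : ∀ q, q ⋖ p → p ∈ J → q ∈ J := fun q hq h => J.lower hq.le h
      have hmax' : Maximal (· ∈ J) p → p ∈ J := fun h => h.prop
      grind
    have hmax : Maximal (· ∈ toggleList o J) p ↔ p ∈ toggleList o J ∧ p ∉ J := by
      rw [maximal_mem_lowerSet_iff_covBy] at key ⊢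
      have hJ : ∀ q, p ⋖ q → q ∈ J → p ∈ J := fun q hq h => J.lower hq.le h
      have hmin' : Minimal (· ∉ J) p → p ∉ J := fun h => h.prop
      grind
    simp only [toggleability, hmin, hmax]
    by_cases h1 : p ∈ J <;> by_cases h2 : p ∈ toggleList o J <;> simp_all

end Toggle

/-! ### Averages over orbits -/

/-- φ permutes each of its orbits, so coboundaries sum to zero there. -/
theorem sum_orbit_comp_apply {S : Type*} (φ : Equiv.Perm S) (g : S → ℝ) (s : S) :
    ∑ᶠ t ∈ MulAction.orbit (Subgroup.zpowers φ) s, g (φ t) =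
      ∑ᶠ t ∈ MulAction.orbit (Subgroup.zpowers φ) s, g t := by
  have hmem : ∀ t, φ t ∈ MulAction.orbit (Subgroup.zpowers φ) s ↔
      t ∈ MulAction.orbit (Subgroup.zpowers φ) s := fun t => by
    have := MulAction.orbit_smul (⟨φ, Subgroup.mem_zpowers φ⟩ : Subgroup.zpowers φ) t
    rw [← MulAction.orbit_eq_iff, ← MulAction.orbit_eq_iff, ← this]
    rfl
  refine finsum_mem_eq_of_bijOn φ ⟨fun t ht => (hmem t).2 ht, φ.injective.injOn, ?_⟩
    fun t _ => rfl
  intro t ht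
  exact ⟨φ.symm t, (hmem _).1 (by simpa using ht), by simp⟩

/-- A statistic that is a constant up to a sum of coboundaries is mesic. -/
theorem isMesic_of_eq_add_sum {S ι : Type*} [Finite S] [Fintype ι] {φ : Equiv.Perm S}
    {f : S → ℝ} {c : ℝ} (w : ι → ℝ) (g : ι → S → ℝ)
    (h : ∀ t, f t = c + ∑ p, w p * (g p (φ t) - g p t)) : IsMesic φ f c := by
  intro s
  have hfin : (MulAction.orbit (Subgroup.zpowers φ) s).Finite := Set.toFinite _
  have hpos : 0 < (MulAction.orbit (Subgroup.zpowers φ) s).ncard :=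
    (Set.ncard_pos hfin).2 ⟨s, MulAction.mem_orbit_self s⟩
  set G : S → ℝ := fun t => ∑ p, w p * g p t with hG
  have h' : ∀ t, f t = (c + G (φ t)) - G t := fun t => by
    rw [h, hG]; simp only [mul_sub, Finset.sum_sub_distrib]; ring
  rw [div_eq_iff (by positivity), finsum_mem_congr rfl (fun t _ => h' t),
    finsum_mem_sub_distrib _ _ hfin,
    finsum_mem_add_distrib hfin, sum_orbit_comp_apply,
    add_sub_cancel_right, finsum_mem_eq_finite_toFinset_sum _ hfin, Finset.sum_const,
    ← Set.ncard_eq_toFinset_card _ hfin, nsmul_eq_mul, mul_comm]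

/-! ### Connected shapes fill their bounding rectangle's rows and columns -/

namespace SkewShape

variable {σ : SkewShape}

theorem mem_cells_iff {i j : ℕ} :
    (i, j) ∈ σ.cells ↔ σ.inner.rowLen i ≤ j ∧ j < σ.outer.rowLen i := by
  rw [cells, Finset.mem_sdiff, YoungDiagram.mem_cells, YoungDiagram.mem_cells,
    YoungDiagram.mem_iff_lt_rowLen, YoungDiagram.mem_iff_lt_rowLen, not_lt, and_comm]

theorem mem_cells_of_le_of_le {i j k l u v : ℕ} (h₁ : (i, j) ∈ σ.cells) (h₂ : (k, l) ∈ σ.cells)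
    (hi : i ≤ u) (hu : u ≤ k) (hj : j ≤ v) (hv : v ≤ l) : (u, v) ∈ σ.cells := by
  simp only [cells, Finset.mem_sdiff, YoungDiagram.mem_cells] at h₁ h₂ ⊢
  exact ⟨σ.outer.up_left_mem hu hv h₂.1, fun hc => h₁.2 (σ.inner.up_left_mem hi hj hc)⟩

theorem covBy_coords {p q : σ.BoxPoset} (h : p ⋖ q) :
    q.1.1 ≤ p.1.1 + 1 ∧ q.1.2 ≤ p.1.2 + 1 := by
  obtain ⟨⟨i, j⟩, hp⟩ := p
  obtain ⟨⟨k, l⟩, hq⟩ := q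
  have hle : i ≤ k ∧ j ≤ l := h.le
  -- Skew shapes are order-convex, so every lattice point between p and q is a box and the cover
  -- forces it to be an endpoint.
  have key : ∀ u v, i ≤ u → u ≤ k → j ≤ v → v ≤ l → (u = i ∧ v = j) ∨ (u = k ∧ v = l) := by
    intro u v h1 h2 h3 h4
    by_contra! hcon
    refine h.2 (c := ⟨(u, v), mem_cells_of_le_of_le hp hq h1 h2 h3 h4⟩)
      (lt_of_le_of_ne (show (i, j) ≤ (u, v) from ⟨h1, h3⟩) ?_)
      (lt_of_le_of_ne (show (u, v) ≤ (k, l) from ⟨h2, h4⟩) ?_)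
    · intro he
      simp only [Subtype.mk.injEq, Prod.mk.injEq] at he
      exact hcon.1 he.1.symm he.2.symm
    · intro he
      simp only [Subtype.mk.injEq, Prod.mk.injEq] at he
      exact hcon.2 he.1 he.2
  constructor
  · by_contra! hcon
    have := key (i + 1) j (by omega) (by simp only at hcon; omega) le_rfl hle.2
    simp only at hcon
    omega
  · by_contra! hcon
    have := key i (j + 1) le_rfl hle.1 (by omega) (by simp only at hcon; omega)
    simp only at hcon
    omega

/-- A function on the boxes of a connected shape that grows by at most one along each cover takes
all values between any two of its values. -/
theorem IsConnected.exists_eq (hσ : σ.IsConnected) {f : σ.BoxPoset → ℕ}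
    (hf : ∀ p q, p ⋖ q → f p ≤ f q ∧ f q ≤ f p + 1) {p q : σ.BoxPoset} {n : ℕ} (hp : f p ≤ n)
    (hq : n ≤ f q) : ∃ x, f x = n := by
  by_contra! hne
  have hwalk : ∀ x y, (SimpleGraph.hasse σ.BoxPoset).Walk x y → f x ≤ n → f y ≤ n := by
    intro x y w
    induction w with
    | nil => exact id
    | @cons u v w h _ ih =>
      intro hu
      apply ih
      have := hne u
      rcases SimpleGraph.hasse_adj.1 h with h | h
      · have := hf _ _ h; omega
      · have := hf _ _ h; omega
  obtain ⟨w⟩ := hσ.preconnected p q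
  have h1 := hwalk p q w hp
  exact hne q (le_antisymm h1 hq)

theorem finset_eq_Ico_of_forall_mem {s : Finset ℕ} (hs : s.Nonempty)
    (h : ∀ x ∈ s, ∀ y ∈ s, ∀ n, x ≤ n → n ≤ y → n ∈ s) :
    s = Finset.Ico (sInf (s : Set ℕ)) (sInf (s : Set ℕ) + s.card) := by
  have hmin : sInf (s : Set ℕ) ∈ s := by simpa using Nat.sInf_mem (s := (s : Set ℕ)) hs
  have hs' : s = Finset.Icc (sInf (s : Set ℕ)) (s.max' hs) := by
    ext n
    rw [Finset.mem_Icc]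
    exact ⟨fun hn => ⟨Nat.sInf_le hn, s.le_max' n hn⟩,
      fun hn => h _ hmin _ (s.max'_mem hs) n hn.1 hn.2⟩
  have hcard : s.card = s.max' hs + 1 - sInf (s : Set ℕ) := by
    conv_lhs => rw [hs', Nat.card_Icc]
  have hle := s.le_max' _ hmin
  rw [hcard]
  conv_lhs => rw [hs']
  ext n
  simp only [Finset.mem_Icc, Finset.mem_Ico]
  omega

theorem IsConnected.cells_nonempty (hσ : σ.IsConnected) : σ.cells.Nonempty := by
  obtain ⟨p⟩ := hσ.nonempty
  exact ⟨p.1, p.2⟩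

/-- The row index rises by at most one along a cover, so connectedness leaves no empty row in
between, and the occupied rows form an interval. -/
theorem IsConnected.exists_mem_row_iff (hσ : σ.IsConnected) {i : ℕ} :
    (∃ j, (i, j) ∈ σ.cells) ↔ σ.topRow ≤ i ∧ i < σ.topRow + σ.height := by
  have hset : ((σ.cells.image Prod.fst : Finset ℕ) : Set ℕ) = {i | ∃ j, (i, j) ∈ σ.cells} := by
    ext; simp
  have := finset_eq_Ico_of_forall_mem (hσ.cells_nonempty.image Prod.fst) (by
    intro x hx y hy n hxn hny
    obtain ⟨p, hp, rfl⟩ := Finset.mem_image.1 hx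
    obtain ⟨q, hq, rfl⟩ := Finset.mem_image.1 hy
    obtain ⟨z, hz⟩ := hσ.exists_eq (f := fun x => x.1.1) (n := n) (p := ⟨p, hp⟩) (q := ⟨q, hq⟩)
      (fun p q h => ⟨h.le.1, (covBy_coords h).1⟩) hxn hny
    exact Finset.mem_image.2 ⟨z.1, z.2, hz⟩)
  rw [hset] at this
  rw [topRow, height, ← Finset.mem_Ico, ← this]
  simp

theorem IsConnected.exists_mem_col_iff (hσ : σ.IsConnected) {j : ℕ} :
    (∃ i, (i, j) ∈ σ.cells) ↔ σ.leftCol ≤ j ∧ j < σ.leftCol + σ.width := by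
  have hset : ((σ.cells.image Prod.snd : Finset ℕ) : Set ℕ) = {j | ∃ i, (i, j) ∈ σ.cells} := by
    ext; simp
  have := finset_eq_Ico_of_forall_mem (hσ.cells_nonempty.image Prod.snd) (by
    intro x hx y hy n hxn hny
    obtain ⟨p, hp, rfl⟩ := Finset.mem_image.1 hx
    obtain ⟨q, hq, rfl⟩ := Finset.mem_image.1 hy
    obtain ⟨z, hz⟩ := hσ.exists_eq (f := fun x => x.1.2) (n := n) (p := ⟨p, hp⟩) (q := ⟨q, hq⟩)
      (fun p q h => ⟨h.le.2, (covBy_coords h).2⟩) hxn hny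
    exact Finset.mem_image.2 ⟨z.1, z.2, hz⟩)
  rw [hset] at this
  rw [leftCol, width, ← Finset.mem_Ico, ← this]
  simp

/-! ### Ideals as row lengths of intermediate diagrams -/

/-- The Young diagram `ν ∪ I` of an order ideal `I` of `λ/ν`. -/
noncomputable def diagram (I : LowerSet σ.BoxPoset) : YoungDiagram where
  cells := by
    classical
    exact σ.outer.cells.filter fun x => ∀ h : x ∈ σ.cells, ⟨x, h⟩ ∈ I
  isLowerSet := by
    rintro ⟨i, j⟩ ⟨k, l⟩ hle hx
    simp only [Finset.coe_filter, Set.mem_ofPred_eq, YoungDiagram.mem_cells] at hx ⊢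
    refine ⟨σ.outer.up_left_mem hle.1 hle.2 hx.1, fun h => ?_⟩
    have hx' : (i, j) ∈ σ.cells := by
      simp only [cells, Finset.mem_sdiff, YoungDiagram.mem_cells] at h ⊢
      exact ⟨hx.1, fun hc => h.2 (σ.inner.up_left_mem hle.1 hle.2 hc)⟩
    exact I.lower (show (⟨(k, l), h⟩ : σ.BoxPoset) ≤ ⟨(i, j), hx'⟩ from hle) (hx.2 hx')

theorem mem_iff_lt_rowLen_diagram (I : LowerSet σ.BoxPoset) (p : σ.BoxPoset) :
    p ∈ I ↔ p.1.2 < (diagram I).rowLen p.1.1 := by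
  rw [← YoungDiagram.mem_iff_lt_rowLen, ← YoungDiagram.mem_cells, diagram]
  have h := p.2
  simp only [Finset.mem_filter, h, forall_true_left, YoungDiagram.mem_cells, Prod.mk.eta]
  simp only [cells, Finset.mem_sdiff, YoungDiagram.mem_cells] at h
  simp [h.1]

theorem rowLen_diagram_le (I : LowerSet σ.BoxPoset) (i : ℕ) :
    (diagram I).rowLen i ≤ σ.outer.rowLen i := by
  by_contra! h
  rw [← YoungDiagram.mem_iff_lt_rowLen, ← YoungDiagram.mem_cells, diagram] at h
  simp only [Finset.mem_filter, YoungDiagram.mem_cells, YoungDiagram.mem_iff_lt_rowLen] at h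
  exact lt_irrefl _ h.1

theorem le_rowLen_diagram (I : LowerSet σ.BoxPoset) (i : ℕ) :
    σ.inner.rowLen i ≤ (diagram I).rowLen i := by
  by_contra! h
  have h' := h
  rw [← YoungDiagram.mem_iff_lt_rowLen] at h'
  refine (lt_irrefl ((diagram I).rowLen i)) ?_
  rw [← YoungDiagram.mem_iff_lt_rowLen, ← YoungDiagram.mem_cells, diagram]
  simp only [Finset.mem_filter, YoungDiagram.mem_cells]
  refine ⟨σ.inner_le h', fun hc => ?_⟩
  rw [mem_cells_iff] at hc
  exact absurd hc.1 h.not_ge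

/-- A maximal box is the end of its row in ν ∪ I with nothing below it. The last conjunct follows
from the first, but is needed once the condition is read off from the row alone. -/
theorem maximal_mem_iff_rowLen {I : LowerSet σ.BoxPoset} {p : σ.BoxPoset} :
    Maximal (· ∈ I) p ↔ p.1.2 + 1 = (diagram I).rowLen p.1.1 ∧
      (diagram I).rowLen (p.1.1 + 1) < (diagram I).rowLen p.1.1 ∧
      σ.inner.rowLen p.1.1 < (diagram I).rowLen p.1.1 := by
  obtain ⟨⟨i, j⟩, hp⟩ := p
  have hc := mem_cells_iff.1 hp
  have hle := rowLen_diagram_le I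
  have hanti : ∀ k, i ≤ k → σ.inner.rowLen k ≤ σ.inner.rowLen i := fun k hk =>
    σ.inner.rowLen_anti _ _ hk
  rw [maximal_mem_lowerSet_iff, mem_iff_lt_rowLen_diagram]
  simp only
  constructor
  · rintro ⟨h1, h2⟩
    have h3 : ¬ j + 1 < (diagram I).rowLen i := fun h => by
      refine h2 ⟨(i, j + 1), mem_cells_iff.2 ⟨by omega, by have := hle i; omega⟩⟩
        (Prod.mk_lt_mk_iff_right.2 (Nat.lt_succ_self j)) ?_
      rw [mem_iff_lt_rowLen_diagram]
      exact h
    have h4 : ¬ j < (diagram I).rowLen (i + 1) := fun h => by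
      refine h2 ⟨(i + 1, j), mem_cells_iff.2 ⟨?_, ?_⟩⟩
        (Prod.mk_lt_mk_iff_left.2 (Nat.lt_succ_self i)) ?_
      · have := hanti (i + 1) (by omega); omega
      · have := hle (i + 1); omega
      · rw [mem_iff_lt_rowLen_diagram]
        exact h
    omega
  · rintro ⟨h1, h2, h3⟩
    refine ⟨by omega, ?_⟩
    rintro ⟨⟨k, l⟩, hq⟩ hlt hqI
    have hkl : i ≤ k ∧ j ≤ l := hlt.le
    rw [mem_iff_lt_rowLen_diagram] at hqI
    simp only at hqI
    rcases hkl.1.eq_or_lt with rfl | hik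
    · have : l = j := by omega
      subst this
      exact lt_irrefl _ hlt
    · have := (diagram I).rowLen_anti (i + 1) k hik
      omega

/-- Dual to the maximal case. The quantifier over the preceding row makes the condition vacuous in
row 0. -/
theorem minimal_notMem_iff_rowLen {I : LowerSet σ.BoxPoset} {p : σ.BoxPoset} :
    Minimal (· ∉ I) p ↔ p.1.2 = (diagram I).rowLen p.1.1 ∧
      (∀ i, p.1.1 = i + 1 → (diagram I).rowLen p.1.1 < (diagram I).rowLen i) ∧
      (diagram I).rowLen p.1.1 < σ.outer.rowLen p.1.1 := by
  obtain ⟨⟨i, j⟩, hp⟩ := p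
  have hc := mem_cells_iff.1 hp
  have hle := le_rowLen_diagram I
  rw [minimal_notMem_lowerSet_iff, mem_iff_lt_rowLen_diagram]
  simp only
  constructor
  · rintro ⟨h1, h2⟩
    have h3 : j = (diagram I).rowLen i := by
      by_contra hne
      have hi := hle i
      have := h2 ⟨(i, j - 1), mem_cells_iff.2 ⟨by omega, by omega⟩⟩
        (Prod.mk_lt_mk_iff_right.2 (by omega))
      rw [mem_iff_lt_rowLen_diagram] at this
      simp only at this
      omega
    refine ⟨h3, ?_, by omega⟩
    rintro k rfl
    by_contra! h
    have hk := hle k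
    have hanti := σ.outer.rowLen_anti k (k + 1) (by omega)
    have := h2 ⟨(k, j), mem_cells_iff.2 ⟨by omega, by omega⟩⟩
        (Prod.mk_lt_mk_iff_left.2 (by omega))
    rw [mem_iff_lt_rowLen_diagram] at this
    simp only at this
    omega
  · rintro ⟨h1, h2, h3⟩
    refine ⟨by omega, ?_⟩
    rintro ⟨⟨k, l⟩, hq⟩ hlt
    have hkl : k ≤ i ∧ l ≤ j := hlt.le
    rw [mem_iff_lt_rowLen_diagram]
    simp only
    rcases hkl.1.eq_or_lt with rfl | hik
    · rcases hkl.2.eq_or_lt with rfl | h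
      · exact absurd hlt (lt_irrefl _)
      · omega
    · obtain ⟨m, rfl⟩ : ∃ m, i = m + 1 := ⟨i - 1, by omega⟩
      have := (diagram I).rowLen_anti k m (by omega)
      have := h2 m rfl
      omega

/-! ### Row lengths inside the bounding rectangle -/

theorem IsConnected.inner_rowLen_lt (hσ : σ.IsConnected) {i : ℕ} (h₁ : σ.topRow ≤ i)
    (h₂ : i < σ.topRow + σ.height) : σ.inner.rowLen i < σ.outer.rowLen i := by
  obtain ⟨j, hj⟩ := hσ.exists_mem_row_iff.2 ⟨h₁, h₂⟩
  rw [mem_cells_iff] at hj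
  omega

theorem IsConnected.exists_row (hσ : σ.IsConnected) {j : ℕ} (h₁ : σ.leftCol ≤ j)
    (h₂ : j < σ.leftCol + σ.width) :
    ∃ k, σ.topRow ≤ k ∧ k < σ.topRow + σ.height ∧ σ.inner.rowLen k ≤ j ∧
      j < σ.outer.rowLen k := by
  obtain ⟨k, hk⟩ := hσ.exists_mem_col_iff.2 ⟨h₁, h₂⟩
  have h3 := hσ.exists_mem_row_iff.1 ⟨j, hk⟩
  exact ⟨k, h3.1, h3.2, mem_cells_iff.1 hk⟩

theorem IsConnected.leftCol_le (hσ : σ.IsConnected) {i : ℕ} (h₁ : σ.topRow ≤ i)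
    (h₂ : i < σ.topRow + σ.height) : σ.leftCol ≤ σ.inner.rowLen i :=
  (hσ.exists_mem_col_iff.1
    ⟨i, mem_cells_iff.2 ⟨le_rfl, hσ.inner_rowLen_lt h₁ h₂⟩⟩).1

theorem IsConnected.outer_rowLen_le (hσ : σ.IsConnected) {i : ℕ} (h₁ : σ.topRow ≤ i)
    (h₂ : i < σ.topRow + σ.height) : σ.outer.rowLen i ≤ σ.leftCol + σ.width := by
  have h := hσ.inner_rowLen_lt h₁ h₂
  have := ((hσ.exists_mem_col_iff (j := σ.outer.rowLen i - 1)).1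
    ⟨i, mem_cells_iff.2 ⟨by omega, by omega⟩⟩).2
  omega

theorem IsConnected.height_pos (hσ : σ.IsConnected) : 0 < σ.height :=
  Finset.card_pos.2 (hσ.cells_nonempty.image _)

theorem IsConnected.width_pos (hσ : σ.IsConnected) : 0 < σ.width :=
  Finset.card_pos.2 (hσ.cells_nonempty.image _)

/-! ### The weight, and its vanishing at outward corners -/

/-- The affine function of the lattice points (in the coordinates of the ambient diagrams) that
vanishes on the diagonal from the southwest to the northeast vertex of the bounding rectangle. -/
noncomputable def weight (σ : SkewShape) (x y : ℕ) : ℝ :=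
  σ.height * ((y : ℝ) - σ.leftCol) + σ.width * ((x : ℝ) - σ.topRow) - σ.height * σ.width

theorem weight_succ_succ (x y : ℕ) :
    σ.weight (x + 1) (y + 1) = σ.weight x y + (σ.height + σ.width) := by
  simp only [weight]; push_cast; ring

/-- A drop of ν between consecutive rows of σ is a northwest outward corner, and there the weight is
-ab times the displacement. -/
theorem IsBalanced.weight_inner_eq_zero (hσ : σ.IsBalanced) {i : ℕ} (h₁ : σ.topRow ≤ i)
    (h₂ : i + 1 < σ.topRow + σ.height) (h : σ.inner.rowLen (i + 1) < σ.inner.rowLen i) :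
    σ.weight (i + 1) (σ.inner.rowLen i) = 0 := by
  have hc := hσ.1
  have hN := hc.leftCol_le (i := i + 1) (by omega) h₂
  have hN' := hc.leftCol_le h₁ (by omega)
  have hL := hc.outer_rowLen_le h₁ (by omega)
  have hlt := hc.inner_rowLen_lt h₁ (by omega)
  -- The column just west of the corner is not empty, and its box must lie below row i; hence row i
  -- + 1 of λ reaches that column.
  obtain ⟨k, -, -, hk, hk'⟩ := hc.exists_row (j := σ.inner.rowLen i - 1) (by omega) (by omega)
  have hik : i + 1 ≤ k := by
    by_contra! hki
    have := σ.inner.rowLen_anti k i (by omega)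
    omega
  have hLk := σ.outer.rowLen_anti _ _ hik
  have hcorner : σ.IsNWCorner (i + 1 - σ.topRow) (σ.inner.rowLen i - σ.leftCol) := by
    refine ⟨⟨(i + 1, σ.inner.rowLen i - 1), mem_cells_iff.2 ⟨by omega, by omega⟩, ?_, ?_⟩,
      ⟨(i, σ.inner.rowLen i), mem_cells_iff.2 ⟨le_rfl, hlt⟩, ?_, ?_⟩, ?_⟩
    · simp only; omega
    · simp only; omega
    · simp only; omega
    · simp only; omega
    · rintro ⟨⟨u, v⟩, hx, hu, hv⟩
      simp only at hu hv
      obtain rfl : u = i := by omega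
      have := (mem_cells_iff.1 hx).1
      omega
  have hd := hσ.2.1 _ _ hcorner
  have ha : (σ.height : ℝ) ≠ 0 := by exact_mod_cast hc.height_pos.ne'
  have hb : (σ.width : ℝ) ≠ 0 := by exact_mod_cast hc.width_pos.ne'
  rw [nwDisplacement, Nat.cast_sub (by omega), Nat.cast_sub hN'] at hd
  rw [weight]
  field_simp at hd
  linarith

theorem IsBalanced.weight_outer_eq_zero (hσ : σ.IsBalanced) {i : ℕ} (h₁ : σ.topRow ≤ i)
    (h₂ : i + 1 < σ.topRow + σ.height) (h : σ.outer.rowLen (i + 1) < σ.outer.rowLen i) :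
    σ.weight (i + 1) (σ.outer.rowLen (i + 1)) = 0 := by
  have hc := hσ.1
  have hN := hc.leftCol_le (i := i + 1) (by omega) h₂
  have hL := hc.outer_rowLen_le h₁ (by omega)
  have hlt := hc.inner_rowLen_lt (i := i + 1) (by omega) (by omega)
  -- The column just east of the corner has a box, necessarily in row i or above, so ν does not
  -- cover that column in row i.
  obtain ⟨k, -, -, hk, hk'⟩ := hc.exists_row (j := σ.outer.rowLen (i + 1)) (by omega) (by omega)
  have hik : k ≤ i := by
    by_contra! hki
    have := σ.outer.rowLen_anti (i + 1) k hki
    omega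
  have hNk := σ.inner.rowLen_anti _ _ hik
  have hcorner : σ.IsSECorner (i + 1 - σ.topRow) (σ.outer.rowLen (i + 1) - σ.leftCol) := by
    refine ⟨⟨(i + 1, σ.outer.rowLen (i + 1) - 1), mem_cells_iff.2 ⟨by omega, by omega⟩, ?_, ?_⟩,
      ⟨(i, σ.outer.rowLen (i + 1)), mem_cells_iff.2 ⟨by omega, h⟩, ?_, ?_⟩, ?_⟩
    · simp only; omega
    · simp only; omega
    · simp only; omega
    · simp only; omega
    · rintro ⟨⟨u, v⟩, hx, hu, hv⟩
      simp only at hu hv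
      obtain rfl : u = i + 1 := by omega
      have := (mem_cells_iff.1 hx).2
      omega
  have hd := hσ.2.2 _ _ hcorner
  have ha : (σ.height : ℝ) ≠ 0 := by exact_mod_cast hc.height_pos.ne'
  have hb : (σ.width : ℝ) ≠ 0 := by exact_mod_cast hc.width_pos.ne'
  rw [seDisplacement, Nat.cast_sub (by omega), Nat.cast_sub (by omega)] at hd
  rw [weight]
  field_simp at hd
  linarith

/-! ### Row contributions and their telescoping sum -/

open Classical in
/-- The contribution of row `i` to the weighted sum over the maximal elements of `I`. -/
noncomputable def maximalWeight (I : LowerSet σ.BoxPoset) (i : ℕ) : ℝ :=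
  if (diagram I).rowLen (i + 1) < (diagram I).rowLen i ∧
      σ.inner.rowLen i < (diagram I).rowLen i then
    σ.weight (i + 1) ((diagram I).rowLen i) else 0

open Classical in
/-- The contribution of row `i` to the weighted sum over the minimal elements of the complement of
`I`. -/
noncomputable def minimalWeight (I : LowerSet σ.BoxPoset) (i : ℕ) : ℝ :=
  if (∀ k, i = k + 1 → (diagram I).rowLen i < (diagram I).rowLen k) ∧
      (diagram I).rowLen i < σ.outer.rowLen i then
    σ.weight i ((diagram I).rowLen i) else 0

open Classical in
-- Each row holds at most one maximal box of I, so the boxes can be indexed by their rows.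
theorem IsConnected.sum_maximal (hσ : σ.IsConnected) (I : LowerSet σ.BoxPoset) :
    ∑ p : σ.BoxPoset, (if Maximal (· ∈ I) p then σ.weight (p.1.1 + 1) (p.1.2 + 1) else 0) =
      ∑ i ∈ Finset.range σ.height, maximalWeight I (σ.topRow + i) := by
  simp only [maximalWeight]
  rw [← Finset.sum_filter, ← Finset.sum_filter]
  refine Finset.sum_bij (fun p _ => p.1.1 - σ.topRow) ?_ ?_ ?_ ?_
  · intro p hp
    have hp' := maximal_mem_iff_rowLen.1 (Finset.mem_filter.1 hp).2
    have hr := (hσ.exists_mem_row_iff (i := p.1.1)).1 ⟨p.1.2, p.2⟩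
    rw [Finset.mem_filter, Finset.mem_range, Nat.add_sub_cancel' hr.1]
    exact ⟨by omega, hp'.2⟩
  · intro p hp q hq hpq
    have hp' := maximal_mem_iff_rowLen.1 (Finset.mem_filter.1 hp).2
    have hq' := maximal_mem_iff_rowLen.1 (Finset.mem_filter.1 hq).2
    have hrp := (hσ.exists_mem_row_iff (i := p.1.1)).1 ⟨p.1.2, p.2⟩
    have hrq := (hσ.exists_mem_row_iff (i := q.1.1)).1 ⟨q.1.2, q.2⟩
    have h1 : p.1.1 = q.1.1 := by omega
    rw [h1] at hp'
    exact Subtype.ext (Prod.ext h1 (by omega))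
  · intro i hi
    rw [Finset.mem_filter, Finset.mem_range] at hi
    have hle := rowLen_diagram_le I (σ.topRow + i)
    refine ⟨⟨(σ.topRow + i, (diagram I).rowLen (σ.topRow + i) - 1),
      mem_cells_iff.2 ⟨by omega, by omega⟩⟩, ?_, by simp⟩
    rw [Finset.mem_filter, maximal_mem_iff_rowLen]
    simp only
    exact ⟨Finset.mem_univ _, by omega, hi.2⟩
  · intro p hp
    have hp' := maximal_mem_iff_rowLen.1 (Finset.mem_filter.1 hp).2
    have hr := (hσ.exists_mem_row_iff (i := p.1.1)).1 ⟨p.1.2, p.2⟩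
    rw [Nat.add_sub_cancel' hr.1, hp'.1]

open Classical in
theorem IsConnected.sum_minimal (hσ : σ.IsConnected) (I : LowerSet σ.BoxPoset) :
    ∑ p : σ.BoxPoset, (if Minimal (· ∉ I) p then σ.weight p.1.1 p.1.2 else 0) =
      ∑ i ∈ Finset.range σ.height, minimalWeight I (σ.topRow + i) := by
  simp only [minimalWeight]
  rw [← Finset.sum_filter, ← Finset.sum_filter]
  refine Finset.sum_bij (fun p _ => p.1.1 - σ.topRow) ?_ ?_ ?_ ?_
  · intro p hp
    have hp' := minimal_notMem_iff_rowLen.1 (Finset.mem_filter.1 hp).2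
    have hr := (hσ.exists_mem_row_iff (i := p.1.1)).1 ⟨p.1.2, p.2⟩
    rw [Finset.mem_filter, Finset.mem_range, Nat.add_sub_cancel' hr.1]
    exact ⟨by omega, hp'.2⟩
  · intro p hp q hq hpq
    have hp' := minimal_notMem_iff_rowLen.1 (Finset.mem_filter.1 hp).2
    have hq' := minimal_notMem_iff_rowLen.1 (Finset.mem_filter.1 hq).2
    have hrp := (hσ.exists_mem_row_iff (i := p.1.1)).1 ⟨p.1.2, p.2⟩
    have hrq := (hσ.exists_mem_row_iff (i := q.1.1)).1 ⟨q.1.2, q.2⟩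
    have h1 : p.1.1 = q.1.1 := by omega
    have h2 := hp'.1
    rw [h1] at h2
    exact Subtype.ext (Prod.ext h1 (h2.trans hq'.1.symm))
  · intro i hi
    rw [Finset.mem_filter, Finset.mem_range] at hi
    refine ⟨⟨(σ.topRow + i, (diagram I).rowLen (σ.topRow + i)),
      mem_cells_iff.2 ⟨le_rowLen_diagram I _, hi.2.2⟩⟩, ?_, by simp⟩
    rw [Finset.mem_filter, minimal_notMem_iff_rowLen]
    exact ⟨Finset.mem_univ _, rfl, hi.2⟩
  · intro p hp
    have hp' := minimal_notMem_iff_rowLen.1 (Finset.mem_filter.1 hp).2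
    have hr := (hσ.exists_mem_row_iff (i := p.1.1)).1 ⟨p.1.2, p.2⟩
    rw [Nat.add_sub_cancel' hr.1, ← hp'.1]

/-- Both terms live on the horizontal line between rows i and i + 1, at the two ends of the path's
run there; the weight has slope a along it. -/
theorem IsBalanced.maximalWeight_sub_minimalWeight (hσ : σ.IsBalanced) (I : LowerSet σ.BoxPoset)
    {i : ℕ} (h₁ : σ.topRow ≤ i) (h₂ : i + 1 < σ.topRow + σ.height) :
    maximalWeight I i - minimalWeight I (i + 1) =
      σ.height * (((diagram I).rowLen i : ℝ) - (diagram I).rowLen (i + 1)) := by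
  have hanti := (diagram I).rowLen_anti i (i + 1) (by omega)
  rcases hanti.eq_or_lt with h | h
  · have h1 : maximalWeight I i = 0 := if_neg fun hc => by omega
    have h2 : minimalWeight I (i + 1) = 0 := if_neg fun hc => by
      have := hc.1 i rfl
      omega
    rw [h1, h2, h]
    ring
  · have h1 : maximalWeight I i = σ.weight (i + 1) ((diagram I).rowLen i) := by
      rw [maximalWeight]
      split_ifs with hc
      · rfl
      -- The turn is not a maximal box only if the path follows ν here; it is then an outward
      -- corner, and the default value 0 is its weight.
      · have hN := le_rowLen_diagram I i
        have hN' := le_rowLen_diagram I (i + 1)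
        have heq : (diagram I).rowLen i = σ.inner.rowLen i := by omega
        rw [heq, hσ.weight_inner_eq_zero h₁ h₂ (by omega)]
    have h2 : minimalWeight I (i + 1) = σ.weight (i + 1) ((diagram I).rowLen (i + 1)) := by
      rw [minimalWeight]
      split_ifs with hc
      · rfl
      · have hL := rowLen_diagram_le I i
        have hL' := rowLen_diagram_le I (i + 1)
        have heq : (diagram I).rowLen (i + 1) = σ.outer.rowLen (i + 1) := by
          by_contra hne
          refine hc ⟨fun k hk => ?_, by omega⟩
          obtain rfl : i = k := by omega
          exact h
        rw [heq, hσ.weight_outer_eq_zero h₁ h₂ (by omega)]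
    rw [h1, h2, weight, weight]
    ring

theorem IsConnected.maximalWeight_last (hσ : σ.IsConnected) (I : LowerSet σ.BoxPoset) {i : ℕ}
    (hi : i + 1 = σ.topRow + σ.height) :
    maximalWeight I i = σ.height * (((diagram I).rowLen i : ℝ) - σ.leftCol) := by
  have ha := hσ.height_pos
  have hb := hσ.width_pos
  have hN := hσ.leftCol_le (i := i) (by omega) (by omega)
  have hlt := hσ.inner_rowLen_lt (i := i) (by omega) (by omega)
  have hM := le_rowLen_diagram I i
  obtain ⟨k, -, hk, hk', hk''⟩ := hσ.exists_row (j := σ.leftCol) le_rfl (by omega)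
  have hNk := σ.inner.rowLen_anti k i (by omega)
  -- Rows of λ may continue below σ, where they agree with ν; they do not extend past the west side
  -- of the rectangle.
  have hnext : (diagram I).rowLen (i + 1) ≤ σ.leftCol := by
    by_contra! hcon
    have hle := rowLen_diagram_le I (i + 1)
    have hNn := σ.inner.rowLen_anti k (i + 1) (by omega)
    have := ((hσ.exists_mem_row_iff (i := i + 1)).1
      ⟨σ.leftCol, mem_cells_iff.2 ⟨by omega, by omega⟩⟩).2
    omega
  have hcast : (i : ℝ) + 1 = σ.topRow + σ.height := by exact_mod_cast hi
  rw [maximalWeight]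
  split_ifs with hc
  · rw [weight]
    push_cast
    rw [hcast]
    ring
  · have : (diagram I).rowLen i = σ.leftCol := by omega
    rw [this]
    ring

/-- This is the weight on the north side of the rectangle; if the path already reaches the northeast
vertex, that weight is 0, the default value. -/
theorem IsConnected.minimalWeight_first (hσ : σ.IsConnected) (I : LowerSet σ.BoxPoset) :
    minimalWeight I σ.topRow =
      σ.height * (((diagram I).rowLen σ.topRow : ℝ) - σ.leftCol) - σ.height * σ.width := by
  have ha := hσ.height_pos
  have hb := hσ.width_pos
  have hL := hσ.outer_rowLen_le (i := σ.topRow) le_rfl (by omega)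
  have hM := rowLen_diagram_le I σ.topRow
  obtain ⟨k, hk, -, hk', hk''⟩ := hσ.exists_row (j := σ.leftCol + σ.width - 1) (by omega) (by omega)
  have hLk := σ.outer.rowLen_anti σ.topRow k hk
  rw [minimalWeight]
  split_ifs with hc
  · rw [weight]
    ring
  · have : (diagram I).rowLen σ.topRow = σ.leftCol + σ.width := by
      by_contra hne
      refine hc ⟨fun m hm => ?_, by omega⟩
      by_contra! hcon
      have hmM := le_rowLen_diagram I m
      have hLm := σ.outer.rowLen_anti m σ.topRow (by omega)
      have := ((hσ.exists_mem_row_iff (i := m)).1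
        ⟨σ.inner.rowLen m, mem_cells_iff.2 ⟨by omega, by omega⟩⟩).1
      omega
    rw [this]
    push_cast
    ring

theorem IsBalanced.sum_maximalWeight_sub (hσ : σ.IsBalanced) (I : LowerSet σ.BoxPoset) :
    ∑ i ∈ Finset.range σ.height, maximalWeight I (σ.topRow + i) -
      ∑ i ∈ Finset.range σ.height, minimalWeight I (σ.topRow + i) = σ.height * σ.width := by
  obtain ⟨n, hn⟩ := Nat.exists_eq_add_one.2 hσ.1.height_pos
  have hmid : ∑ i ∈ Finset.range n, maximalWeight I (σ.topRow + i) -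
      ∑ i ∈ Finset.range n, minimalWeight I (σ.topRow + (i + 1)) =
      σ.height * (((diagram I).rowLen σ.topRow : ℝ) - (diagram I).rowLen (σ.topRow + n)) := by
    have htel := Finset.sum_range_sub' (fun i => ((diagram I).rowLen (σ.topRow + i) : ℝ)) n
    rw [add_zero] at htel
    rw [← Finset.sum_sub_distrib, ← htel, Finset.mul_sum]
    refine Finset.sum_congr rfl fun i hi => ?_
    rw [Finset.mem_range] at hi
    exact hσ.maximalWeight_sub_minimalWeight I (by omega) (by omega)
  have hlast := hσ.1.maximalWeight_last I (i := σ.topRow + n) (by omega)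
  have hfirst := hσ.1.minimalWeight_first I
  -- The last maximal term and the first minimal term are split off, pairing the remaining terms
  -- across the lines between rows.
  rw [hn, Finset.sum_range_succ, Finset.sum_range_succ', ← hn, add_zero]
  linarith

/-- On a balanced shape the antichain cardinality is constant up to a linear combination of
signed toggleability statistics. -/
theorem IsBalanced.antichainCard_eq (hσ : σ.IsBalanced) (I : LowerSet σ.BoxPoset) :
    antichainCard I = ((σ.height : ℝ) * σ.width) / ((σ.height : ℝ) + σ.width) +
      ∑ p : σ.BoxPoset, σ.weight p.1.1 p.1.2 / ((σ.height : ℝ) + σ.width) *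
        toggleability p I := by
  classical
  have ha : (0 : ℝ) < σ.height := by exact_mod_cast hσ.1.height_pos
  have hb : (0 : ℝ) < σ.width := by exact_mod_cast hσ.1.width_pos
  have hcard : antichainCard I = ∑ p : σ.BoxPoset, if Maximal (· ∈ I) p then (1 : ℝ) else 0 := by
    rw [antichainCard, Finset.sum_boole, ← Set.ncard_coe_finset]
    simp
  have h := hσ.sum_maximalWeight_sub I
  rw [← hσ.1.sum_maximal, ← hσ.1.sum_minimal, ← Finset.sum_sub_distrib] at h
  have hsum : ((σ.height : ℝ) + σ.width) * antichainCard I -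
      ∑ p : σ.BoxPoset, σ.weight p.1.1 p.1.2 * toggleability p I = σ.height * σ.width := by
    rw [← h, hcard, Finset.mul_sum, ← Finset.sum_sub_distrib]
    refine Finset.sum_congr rfl fun p _ => ?_
    -- Passing from the northwest to the southeast vertex of a maximal box contributes the a + b
    -- that counts it.
    rw [weight_succ_succ, toggleability]
    split_ifs <;> ring
  simp only [div_mul_eq_mul_div]
  rw [← Finset.sum_div, ← add_div, eq_div_iff (by positivity)]
  linarith

end SkewShape

theorem mainTheorem4 (σ : SkewShape) (hσ : σ.IsBalanced)
    (φ : Equiv.Perm (LowerSet σ.BoxPoset)) (hφ : IsRowmotion φ ∨ IsGyration φ) :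
    IsMesic φ antichainCard
      (((σ.height : ℝ) * (σ.width : ℝ)) / ((σ.height : ℝ) + (σ.width : ℝ))) := by
  have hT : ∀ p, ∃ g : LowerSet σ.BoxPoset → ℝ, ∀ I, toggleability p I = g (φ I) - g I :=
    fun p => hφ.elim (fun h => h.toggleability_eq p) (fun h => h.toggleability_eq p)
  choose g hg using hT
  refine isMesic_of_eq_add_sum
    (fun p => σ.weight p.1.1 p.1.2 / ((σ.height : ℝ) + σ.width)) g fun I => ?_
  simp only [hσ.antichainCard_eq I, hg]
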